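/- **Theorem.** For a square complex matrix $X$ with singular values $\sigma_1(X),\sigma_2(X),\dots$ let $\|X\|_p=\big(\sum_k\sigma_k(X)^p\big)^{1/p}$ for $1\le p<\infty$ and $\|X\|_\infty=\max_k\sigma_k(X)$ be its Schatten $p$-norm, let $\operatorname{Re}X=\tfrac12(X+X^*)$, and let $$\omega_p(X)=\sup_{\theta\in\mathbb R}\big\|\operatorname{Re}(e^{i\theta}X)\big\|_p$$ be its Schatten $p$-generalized numerical radius; write $\omega_p^p(X)=(\omega_p(X))^p$. Let $A=\begin{bmatrix}A_{11}&A_{12}\\A_{21}&A_{22}\end{bmatrix}$ be a complex $2\times2$ block matrix with square diagonal blocks $A_{11}$ ($m\times m$) and $A_{22}$ ($n\times n$). Put $$a_{ii}=A_{ii},\qquad a_{ij}=2^{-1/p}\begin{bmatrix}0&A_{ij}\\A_{ji}&0\end{bmatrix}\quad(i\ne j),$$ with $1/\infty=0$. Then: 1. if $2\le p<\infty$, then $\displaystyle \omega_p^p(A)\le 2^{\,p-2}\sum_{i,j=1}^2\omega_p^p(a_{ij})$; and for $p=\infty$ (the limiting form of the $p$-th root of this inequality) $\displaystyle \omega_\infty(A)\le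 2\max_{1\le i,j\le2}\omega_\infty(a_{ij})$; 2. if $1\le p\le2$, then $\displaystyle \omega_p^p(A)\le\sum_{i,j=1}^2\omega_p^p(a_{ij})$. -/

import Mathlib

open scoped ENNReal ComplexStarModule

noncomputable section

/-- The singular values of a square complex matrix `X`, counted with multiplicity: the square
roots of the eigenvalues of `Xᴴ * X`. -/
def matrixSingularValues {n : Type*} [Fintype n] [DecidableEq n] (X : Matrix n n ℂ) : n → ℝ :=
  fun i => √((Matrix.isHermitian_conjTranspose_mul_self X).eigenvalues i)

/-- The Schatten `p`-norm of a square complex matrix: the `ℓᵖ` norm of its singular values, i.e.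
`(∑ i, σ i ^ p) ^ (1 / p)` for `p < ∞` and the largest singular value (the operator norm) for
`p = ∞`. -/
def schattenNorm {n : Type*} [Fintype n] [DecidableEq n] (p : ℝ≥0∞) (X : Matrix n n ℂ) : ℝ :=
  ‖(WithLp.toLp p (matrixSingularValues X) : PiLp p (fun _ : n => ℝ))‖

/-- The Schatten `p`-generalized numerical radius `ω_p(X) = sup_θ ‖Re (exp (i θ) X)‖_p`, where
`ℜ Y = (Y + Yᴴ) / 2`. -/
def schattenRadius {n : Type*} [Fintype n] [DecidableEq n] (p : ℝ≥0∞) (X : Matrix n n ℂ) : ℝ :=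
  ⨆ θ : ℝ, schattenNorm p ((ℜ (Complex.exp (θ * Complex.I) • X) : Matrix n n ℂ))

/-- The matrix `2 ^ (-1 / p) • [[0, B], [C, 0]]`; here `1 / p = 0` when `p = ∞`. -/
def scaledOffDiag {m n : Type*} (p : ℝ≥0∞) (B : Matrix m n ℂ) (C : Matrix n m ℂ) :
    Matrix (m ⊕ n) (m ⊕ n) ℂ :=
  ((2 : ℝ) ^ (-(p⁻¹).toReal)) • Matrix.fromBlocks 0 B C 0

end

/-!
Rotating by `θ` and taking real parts turns the claim into one about a single Hermitian block matrix
`H = D + O`, with `D` its block diagonal and `O` its block off-diagonal part. Two observations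
reduce this to a Clarkson–McCarthy inequality for `D` and `O`. First, `D - O` is the conjugate of
`D + O` by the unitary `diag(1, -1)`, so both have the same singular values. Second,
`ℜ (exp (i θ) a₁₂)` is `2 ^ (-1 / p) • O`, and `ℜ (exp (i θ) a₂₁)` is the same matrix with the blocks
listed in the opposite order; each of them carries half of `‖O‖ₚᵖ`.

The Clarkson–McCarthy inequalities follow from the parallelogram identity
`(A + B)ᴴ(A + B) + (A - B)ᴴ(A - B) = 2 (AᴴA + BᴴB)` and two facts about positive `P`, `Q` and a
convex `f` with `f 0 = 0`, namely `2 tr f((P + Q) / 2) ≤ tr f(P) + tr f(Q) ≤ tr f(P + Q)`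
(`ConvexOn.two_mul_sum_half_le_of_quadForm_add` and `ConvexOn.sum_add_sum_le_of_quadForm_add`). Both
are Jensen's inequality for weights built from the inner products of the eigenvectors. They are
stated for quadratic forms diagonalized in orthonormal bases, so no functional calculus is needed.

The function `f t = t ^ (p / 2)` is convex for `p ≥ 2`, while for `p ≤ 2` the function `-f` is
convex; this yields the two finite cases (`ConvexOn.singularSum_fromBlocks_le` and
`ConcaveOn.singularSum_fromBlocks_le`). The case `p = ∞` is the choice `f t = max (t - (2 c)²) 0`,
where `c` bounds the operator norms of `D` and `O`.
-/

open scoped ComplexOrder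
open Matrix

/-! ### Trace inequalities for sums of positive quadratic forms -/

section QuadraticForms

variable {E : Type*} [NormedAddCommGroup E] [InnerProductSpace ℂ E]
  {ι κ μ : Type*} [Fintype ι] [Fintype κ] [Fintype μ]

/-- If positive operators `P ≤ S` have eigenbases `v`, `e` with eigenvalues `l`, `s`, then every
eigenvalue `l i` is a substochastic average of the `s k`, with weights
`l i * |⟪v i, e k⟫|² / s k` (zero where `s k = 0`), so Jensen's inequality applies. That the weights
add up to at most one is the inequality `l i * ⟪v i, S⁻¹ (v i)⟫ ≤ 1`. The operators enter only
through their quadratic forms. -/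
theorem ConvexOn.map_le_sum_of_quadForm_le {f : ℝ → ℝ} (hf : ConvexOn ℝ (Set.Ici 0) f)
    (hf0 : f 0 = 0) (v : OrthonormalBasis ι ℂ E) (e : OrthonormalBasis κ ℂ E)
    {l : ι → ℝ} {s : κ → ℝ} (hl : ∀ i, 0 ≤ l i) (hs : ∀ k, 0 ≤ s k)
    (h : ∀ x, ∑ i, l i * ‖inner ℂ (v i) x‖ ^ 2 ≤ ∑ k, s k * ‖inner ℂ (e k) x‖ ^ 2) (i : ι) :
    f (l i) ≤ ∑ k, l i * ‖inner ℂ (v i) (e k)‖ ^ 2 / s k * f (s k) := by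
  classical
  have hsingle : ∀ x, l i * ‖inner ℂ (v i) x‖ ^ 2 ≤ ∑ k, s k * ‖inner ℂ (e k) x‖ ^ 2 := fun x =>
    (Finset.single_le_sum (f := fun i => l i * ‖inner ℂ (v i) x‖ ^ 2)
      (fun j _ => mul_nonneg (hl j) (sq_nonneg _)) (Finset.mem_univ i)).trans (h x)
  -- where `s k = 0` the weight `l i * ‖⟪v i, e k⟫‖ ^ 2` vanishes as well
  have hzero : ∀ k, s k = 0 → l i * ‖inner ℂ (v i) (e k)‖ ^ 2 = 0 := by
    intro k hk
    refine le_antisymm ((hsingle (e k)).trans (Finset.sum_nonpos fun j _ => ?_))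
      (mul_nonneg (hl i) (sq_nonneg _))
    by_cases hjk : j = k
    · simp [hjk, hk]
    · simp [orthonormal_iff_ite.mp e.orthonormal, hjk]
  set t : ℝ := ∑ k, ‖inner ℂ (v i) (e k)‖ ^ 2 / s k with ht
  have ht0 : 0 ≤ t := Finset.sum_nonneg fun k _ => div_nonneg (sq_nonneg _) (hs k)
  -- testing the hypothesis on `x = S⁻¹ (v i)` yields `l i * t ^ 2 ≤ t`
  have hlt : l i * t ≤ 1 := by
    set x : E := ∑ k, (((s k)⁻¹ : ℝ) * inner ℂ (e k) (v i) : ℂ) • e k with hx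
    have hex : ∀ k, inner ℂ (e k) x = ((s k)⁻¹ : ℝ) * inner ℂ (e k) (v i) := fun k =>
      e.orthonormal.inner_right_fintype _ k
    have hvx : inner ℂ (v i) x = (t : ℂ) := by
      rw [hx, inner_sum, ht, Complex.ofReal_sum]
      refine Finset.sum_congr rfl fun k _ => ?_
      rw [inner_smul_right, mul_assoc, ← inner_conj_symm (e k) (v i), Complex.conj_mul']
      push_cast
      ring
    have key := hsingle x
    have hR : ∑ k, s k * ‖inner ℂ (e k) x‖ ^ 2 = t := by
      refine Finset.sum_congr rfl fun k _ => ?_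
      rw [hex, norm_mul, mul_pow, norm_inner_symm, Complex.norm_real, Real.norm_eq_abs, sq_abs]
      by_cases hk : s k = 0
      · simp [hk]
      · field_simp
    rw [hR, hvx, Complex.norm_real, Real.norm_eq_abs, sq_abs] at key
    rcases ht0.eq_or_lt with h0 | h0
    · simp [← h0]
    · nlinarith
  have hw : ∑ k, l i * ‖inner ℂ (v i) (e k)‖ ^ 2 / s k = l i * t := by
    rw [ht, Finset.mul_sum]
    exact Finset.sum_congr rfl fun k _ => mul_div_assoc _ _ _
  have hmean : ∑ k, l i * ‖inner ℂ (v i) (e k)‖ ^ 2 / s k * s k = l i := by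
    have : ∀ k, l i * ‖inner ℂ (v i) (e k)‖ ^ 2 / s k * s k = l i * ‖inner ℂ (v i) (e k)‖ ^ 2 := by
      intro k
      by_cases hk : s k = 0
      · simp [hk, hzero k hk]
      · field_simp
    rw [Finset.sum_congr rfl fun k _ => this k, ← Finset.mul_sum, e.sum_sq_norm_inner_left,
      v.orthonormal.1 i]
    simp
  have := hf.map_add_sum_le (t := Finset.univ) (v := 1 - l i * t) (q := 0) (p := s)
    (w := fun k => l i * ‖inner ℂ (v i) (e k)‖ ^ 2 / s k)
    (fun k _ => div_nonneg (mul_nonneg (hl i) (sq_nonneg _)) (hs k)) (by rw [hw]; ring)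
    (fun k _ => hs k) (by linarith) (Set.mem_Ici.2 le_rfl)
  simpa [hf0, hmean] using this

/-- Superadditivity of `P ↦ tr f(P)`: for positive operators with `P + Q = S`,
`tr f(P) + tr f(Q) ≤ tr f(S)` whenever `f` is convex with `f 0 = 0`. The weights from
`ConvexOn.map_le_sum_of_quadForm_le` for `P` and for `Q` together have column sums `1`. -/
theorem ConvexOn.sum_add_sum_le_of_quadForm_add {f : ℝ → ℝ} (hf : ConvexOn ℝ (Set.Ici 0) f)
    (hf0 : f 0 = 0) (v : OrthonormalBasis ι ℂ E) (u : OrthonormalBasis μ ℂ E)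
    (e : OrthonormalBasis κ ℂ E) {l : ι → ℝ} {r : μ → ℝ} {s : κ → ℝ}
    (hl : ∀ i, 0 ≤ l i) (hr : ∀ j, 0 ≤ r j) (hs : ∀ k, 0 ≤ s k)
    (h : ∀ x, ∑ i, l i * ‖inner ℂ (v i) x‖ ^ 2 + ∑ j, r j * ‖inner ℂ (u j) x‖ ^ 2 =
      ∑ k, s k * ‖inner ℂ (e k) x‖ ^ 2) :
    ∑ i, f (l i) + ∑ j, f (r j) ≤ ∑ k, f (s k) := by
  classical
  have hq : ∀ x, 0 ≤ ∑ i, l i * ‖inner ℂ (v i) x‖ ^ 2 := fun x =>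
    Finset.sum_nonneg fun j _ => mul_nonneg (hl j) (sq_nonneg _)
  have hq' : ∀ x, 0 ≤ ∑ i, r i * ‖inner ℂ (u i) x‖ ^ 2 := fun x =>
    Finset.sum_nonneg fun j _ => mul_nonneg (hr j) (sq_nonneg _)
  have h1 := fun i => hf.map_le_sum_of_quadForm_le hf0 v e hl hs
    (fun x => by linarith [h x, hq' x]) i
  have h2 := fun i => hf.map_le_sum_of_quadForm_le hf0 u e hr hs
    (fun x => by linarith [h x, hq x]) i
  refine (add_le_add (Finset.sum_le_sum fun i _ => h1 i)
    (Finset.sum_le_sum fun i _ => h2 i)).trans_eq ?_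
  rw [Finset.sum_comm, Finset.sum_comm (s := (Finset.univ : Finset μ)), ← Finset.sum_add_distrib]
  refine Finset.sum_congr rfl fun k _ => ?_
  rw [← Finset.sum_mul, ← Finset.sum_mul, ← add_mul, ← Finset.sum_div, ← Finset.sum_div, ← add_div,
    h (e k)]
  by_cases hk : s k = 0
  · simp [hk, hf0]
  · simp [orthonormal_iff_ite.mp e.orthonormal, apply_ite, hk]

/-- Midpoint convexity of the trace function: if `P + Q = S` are diagonalized by `v`, `u`, `e`,
then `2 tr f(S / 2) ≤ tr f(P) + tr f(Q)`. The diagonal entries of `P` and `Q` in the basis `e` are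
averages of their eigenvalues with doubly stochastic weights. -/
theorem ConvexOn.two_mul_sum_half_le_of_quadForm_add {f : ℝ → ℝ}
    (hf : ConvexOn ℝ (Set.Ici 0) f) (v : OrthonormalBasis ι ℂ E) (u : OrthonormalBasis μ ℂ E)
    (e : OrthonormalBasis κ ℂ E) {l : ι → ℝ} {r : μ → ℝ} {s : κ → ℝ}
    (hl : ∀ i, 0 ≤ l i) (hr : ∀ j, 0 ≤ r j)
    (h : ∀ x, ∑ i, l i * ‖inner ℂ (v i) x‖ ^ 2 + ∑ j, r j * ‖inner ℂ (u j) x‖ ^ 2 =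
      ∑ k, s k * ‖inner ℂ (e k) x‖ ^ 2) :
    2 * ∑ k, f (s k / 2) ≤ ∑ i, f (l i) + ∑ j, f (r j) := by
  classical
  have key : ∀ k, 2 * f (s k / 2) ≤ ∑ i, ‖inner ℂ (v i) (e k)‖ ^ 2 * f (l i) +
      ∑ j, ‖inner ℂ (u j) (e k)‖ ^ 2 * f (r j) := by
    intro k
    have hk : s k = ∑ i, ‖inner ℂ (v i) (e k)‖ ^ 2 * l i +
        ∑ j, ‖inner ℂ (u j) (e k)‖ ^ 2 * r j := by
      have := h (e k)
      simp only [mul_comm (_ ^ 2 : ℝ)]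
      rw [this]
      simp [orthonormal_iff_ite.mp e.orthonormal, apply_ite]
    have h1 := hf.map_sum_le (t := Finset.univ) (w := fun i => ‖inner ℂ (v i) (e k)‖ ^ 2) (p := l)
      (fun i _ => sq_nonneg _)
      (by rw [v.sum_sq_norm_inner_right, e.orthonormal.1 k]; simp) (fun i _ => hl i)
    have h2 := hf.map_sum_le (t := Finset.univ) (w := fun i => ‖inner ℂ (u i) (e k)‖ ^ 2) (p := r)
      (fun i _ => sq_nonneg _)
      (by rw [u.sum_sq_norm_inner_right, e.orthonormal.1 k]; simp) (fun i _ => hr i)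
    simp only [smul_eq_mul] at h1 h2
    have hx : ∑ i, ‖inner ℂ (v i) (e k)‖ ^ 2 * l i ∈ Set.Ici (0 : ℝ) :=
      Finset.sum_nonneg fun i _ => mul_nonneg (sq_nonneg _) (hl i)
    have hy : ∑ j, ‖inner ℂ (u j) (e k)‖ ^ 2 * r j ∈ Set.Ici (0 : ℝ) :=
      Finset.sum_nonneg fun j _ => mul_nonneg (sq_nonneg _) (hr j)
    have h3 := hf.2 hx hy (show (0 : ℝ) ≤ 1 / 2 by norm_num) (show (0 : ℝ) ≤ 1 / 2 by norm_num)
      (by norm_num)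
    simp only [smul_eq_mul, ← mul_add, ← hk] at h3
    rw [show s k / 2 = 1 / 2 * s k by ring]
    linarith
  rw [Finset.mul_sum]
  refine (Finset.sum_le_sum fun k _ => key k).trans_eq ?_
  rw [Finset.sum_add_distrib, Finset.sum_comm,
    Finset.sum_comm (t := (Finset.univ : Finset μ))]
  simp_rw [← Finset.sum_mul, e.sum_sq_norm_inner_left]
  simp

end QuadraticForms

/-! ### Trace functions of the squared singular values -/

section SingularSum

variable {m n : Type*} [Fintype m] [DecidableEq m] [Fintype n] [DecidableEq n]

theorem Matrix.IsHermitian.sum_eigenvalues_mul_norm_inner_sq {P : Matrix n n ℂ}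
    (hP : P.IsHermitian) (x : EuclideanSpace ℂ n) :
    ∑ i, hP.eigenvalues i * ‖inner ℂ (hP.eigenvectorBasis i) x‖ ^ 2 =
      (inner ℂ x (P.toEuclideanLin x)).re := by
  rw [← hP.eigenvectorBasis.sum_inner_mul_inner, Complex.re_sum]
  refine Finset.sum_congr rfl fun i _ => ?_
  have hv : P.toEuclideanLin (hP.eigenvectorBasis i) =
      (hP.eigenvalues i : ℂ) • hP.eigenvectorBasis i := by
    ext j
    simpa [Matrix.toLpLin_apply] using congrFun (hP.mulVec_eigenvectorBasis i) j
  rw [← (isSymmetric_toEuclideanLin_iff.mpr hP) (hP.eigenvectorBasis i) x, hv, inner_smul_left,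
    Complex.conj_ofReal, mul_left_comm, Complex.re_ofReal_mul, ← inner_conj_symm x,
    Complex.conj_mul', ← Complex.ofReal_pow, Complex.ofReal_re]

theorem re_inner_conjTranspose_mul_self (X : Matrix n n ℂ) (x : EuclideanSpace ℂ n) :
    (inner ℂ x ((Xᴴ * X).toEuclideanLin x)).re = ‖X.toEuclideanLin x‖ ^ 2 := by
  have : (Xᴴ * X).toEuclideanLin x = Xᴴ.toEuclideanLin (X.toEuclideanLin x) := by
    ext; simp [Matrix.toLpLin_apply, Matrix.mulVec_mulVec]
  rw [this, Matrix.toEuclideanLin_conjTranspose_eq_adjoint, LinearMap.adjoint_inner_right,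
    inner_self_eq_norm_sq_to_K]
  norm_cast

/-- The trace of `f (Xᴴ * X)`: the sum of `f (σ ^ 2)` over the singular values `σ` of `X`. -/
noncomputable def singularSum (f : ℝ → ℝ) (X : Matrix n n ℂ) : ℝ :=
  ∑ i, f ((isHermitian_conjTranspose_mul_self X).eigenvalues i)

theorem singularSum_eq_sum_roots (f : ℝ → ℝ) (X : Matrix n n ℂ) :
    singularSum f X = ((Xᴴ * X).charpoly.roots.map fun z => f z.re).sum := by
  rw [(isHermitian_conjTranspose_mul_self X).roots_charpoly_eq_eigenvalues, Multiset.map_map]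
  simp [singularSum]

theorem singularSum_congr {f g : ℝ → ℝ} (h : ∀ t, 0 ≤ t → f t = g t) (X : Matrix n n ℂ) :
    singularSum f X = singularSum g X :=
  Finset.sum_congr rfl fun i _ => h _ (eigenvalues_conjTranspose_mul_self_nonneg X i)

theorem singularSum_mul_left (c : ℝ) (f : ℝ → ℝ) (X : Matrix n n ℂ) :
    singularSum (fun t => c * f t) X = c * singularSum f X := by
  simp [singularSum, Finset.mul_sum]

theorem Matrix.IsHermitian.charpoly_real_smul {P : Matrix n n ℂ} (hP : P.IsHermitian) (c : ℝ) :
    (c • P).charpoly =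
      ∏ i, (Polynomial.X - Polynomial.C ((c * hP.eigenvalues i : ℝ) : ℂ)) := by
  have h : (c • diagonal (RCLike.ofReal ∘ hP.eigenvalues) : Matrix n n ℂ) =
      diagonal fun i => ((c * hP.eigenvalues i : ℝ) : ℂ) := by
    ext i j
    by_cases hij : i = j <;> simp [hij]
  conv_lhs => rw [hP.spectral_theorem, Unitary.conjStarAlgAut_apply, ← smul_mul_assoc,
    ← mul_smul_comm, charpoly_mul_comm, ← mul_assoc, Unitary.coe_star_mul_self, one_mul, h,
    charpoly_diagonal]

theorem singularSum_real_smul (f : ℝ → ℝ) (c : ℝ) (X : Matrix n n ℂ) :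
    singularSum f (c • X) = singularSum (fun t => f (c ^ 2 * t)) X := by
  have h : (c • X)ᴴ * (c • X) = c ^ 2 • (Xᴴ * X) := by
    simp [smul_smul, sq]
  rw [singularSum_eq_sum_roots, h,
    (isHermitian_conjTranspose_mul_self X).charpoly_real_smul, Polynomial.roots_prod]
  · simp only [singularSum, Polynomial.roots_X_sub_C, Multiset.bind_singleton, Multiset.map_map]
    simp only [Function.comp_def, Complex.ofReal_re]
    rfl
  · exact Finset.prod_ne_zero_iff.2 fun i _ => Polynomial.X_sub_C_ne_zero _

theorem singularSum_fromBlocks_diag (f : ℝ → ℝ) (X : Matrix m m ℂ) (Y : Matrix n n ℂ) :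
    singularSum f (fromBlocks X 0 0 Y) = singularSum f X + singularSum f Y := by
  rw [singularSum_eq_sum_roots, singularSum_eq_sum_roots, singularSum_eq_sum_roots,
    fromBlocks_conjTranspose, fromBlocks_multiply]
  simp only [conjTranspose_zero, Matrix.zero_mul, Matrix.mul_zero, add_zero, zero_add]
  rw [charpoly_fromBlocks_zero₁₂, Polynomial.roots_mul, Multiset.map_add, Multiset.sum_add]
  exact mul_ne_zero (charpoly_monic _).ne_zero (charpoly_monic _).ne_zero

theorem singularSum_reindex (f : ℝ → ℝ) (e : m ≃ n) (X : Matrix m m ℂ) :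
    singularSum f (reindex e e X) = singularSum f X := by
  rw [singularSum_eq_sum_roots, singularSum_eq_sum_roots, ← charpoly_reindex e]
  simp [submatrix_mul_equiv, conjTranspose_submatrix]

/-- Conjugation by the unitary `diag(1, -1)` changes the sign of the off-diagonal blocks. -/
theorem singularSum_fromBlocks_neg (f : ℝ → ℝ) (A : Matrix m m ℂ) (B : Matrix m n ℂ)
    (C : Matrix n m ℂ) (D : Matrix n n ℂ) :
    singularSum f (fromBlocks A (-B) (-C) D) = singularSum f (fromBlocks A B C D) := by
  have hU : (fromBlocks 1 0 0 (-1) : Matrix (m ⊕ n) (m ⊕ n) ℂ) * fromBlocks 1 0 0 (-1) = 1 := by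
    simp [fromBlocks_multiply]
  have h : (fromBlocks A (-B) (-C) D)ᴴ * fromBlocks A (-B) (-C) D =
      fromBlocks 1 0 0 (-1) * ((fromBlocks A B C D)ᴴ * fromBlocks A B C D *
        fromBlocks 1 0 0 (-1)) := by
    simp [fromBlocks_multiply, fromBlocks_conjTranspose, add_comm]
  rw [singularSum_eq_sum_roots, singularSum_eq_sum_roots, h, charpoly_mul_comm, mul_assoc, hU,
    mul_one]

/-- The quadratic form of `Xᴴ * X` in the orthonormal basis of right singular vectors of `X`. -/
theorem sum_eigenvalues_conjTranspose_mul_self (X : Matrix n n ℂ) (x : EuclideanSpace ℂ n) :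
    ∑ i, (isHermitian_conjTranspose_mul_self X).eigenvalues i *
      ‖inner ℂ ((isHermitian_conjTranspose_mul_self X).eigenvectorBasis i) x‖ ^ 2 =
      ‖X.toEuclideanLin x‖ ^ 2 := by
  rw [Matrix.IsHermitian.sum_eigenvalues_mul_norm_inner_sq, re_inner_conjTranspose_mul_self]

theorem ConvexOn.comp_mul_left_Ici {f : ℝ → ℝ} (hf : ConvexOn ℝ (Set.Ici 0) f) {c : ℝ}
    (hc : 0 ≤ c) : ConvexOn ℝ (Set.Ici 0) fun t => f (c * t) := by
  refine ⟨convex_Ici 0, fun x hx y hy a b ha hb hab => ?_⟩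
  have := hf.2 (Set.mem_Ici.2 (mul_nonneg hc hx)) (Set.mem_Ici.2 (mul_nonneg hc hy)) ha hb hab
  simp only [smul_eq_mul] at this ⊢
  rwa [show c * (a * x + b * y) = a * (c * x) + b * (c * y) by ring]

/-! ### Clarkson–McCarthy inequalities -/

section Clarkson

theorem posSemidef_conjTranspose_mul_self_add {n : Type*} [Fintype n] (A B : Matrix n n ℂ) :
    (Aᴴ * A + Bᴴ * B).PosSemidef :=
  (posSemidef_conjTranspose_mul_self A).add (posSemidef_conjTranspose_mul_self B)

variable {f : ℝ → ℝ} (A B : Matrix n n ℂ)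

/-- The identity of quadratic forms behind `Aᴴ A + Bᴴ B`, each of the three matrices being
written in its own orthonormal eigenbasis. -/
theorem sum_eigenvalues_add_sum_eigenvalues (x : EuclideanSpace ℂ n) :
    ∑ i, (isHermitian_conjTranspose_mul_self A).eigenvalues i *
        ‖inner ℂ ((isHermitian_conjTranspose_mul_self A).eigenvectorBasis i) x‖ ^ 2 +
      ∑ i, (isHermitian_conjTranspose_mul_self B).eigenvalues i *
        ‖inner ℂ ((isHermitian_conjTranspose_mul_self B).eigenvectorBasis i) x‖ ^ 2 =
      ∑ i, (posSemidef_conjTranspose_mul_self_add A B).isHermitian.eigenvalues i *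
        ‖inner ℂ ((posSemidef_conjTranspose_mul_self_add A B).isHermitian.eigenvectorBasis i) x‖ ^ 2 := by
  simp only [Matrix.IsHermitian.sum_eigenvalues_mul_norm_inner_sq, map_add, LinearMap.add_apply,
    inner_add_right, Complex.add_re]

/-- The parallelogram identity `(A + B)ᴴ(A + B) + (A - B)ᴴ(A - B) = 2 (AᴴA + BᴴB)`, in
orthonormal eigenbases of the matrices involved. -/
theorem sum_eigenvalues_add_sum_eigenvalues_sub (x : EuclideanSpace ℂ n) :
    ∑ i, (isHermitian_conjTranspose_mul_self (A + B)).eigenvalues i *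
        ‖inner ℂ ((isHermitian_conjTranspose_mul_self (A + B)).eigenvectorBasis i) x‖ ^ 2 +
      ∑ i, (isHermitian_conjTranspose_mul_self (A - B)).eigenvalues i *
        ‖inner ℂ ((isHermitian_conjTranspose_mul_self (A - B)).eigenvectorBasis i) x‖ ^ 2 =
      ∑ i, 2 * (posSemidef_conjTranspose_mul_self_add A B).isHermitian.eigenvalues i *
        ‖inner ℂ ((posSemidef_conjTranspose_mul_self_add A B).isHermitian.eigenvectorBasis i) x‖ ^ 2 := by
  simp only [mul_assoc]
  rw [← Finset.mul_sum, ← sum_eigenvalues_add_sum_eigenvalues,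
    sum_eigenvalues_conjTranspose_mul_self, sum_eigenvalues_conjTranspose_mul_self,
    sum_eigenvalues_conjTranspose_mul_self, sum_eigenvalues_conjTranspose_mul_self]
  simpa [sq] using parallelogram_law_with_norm ℂ (A.toEuclideanLin x) (B.toEuclideanLin x)

/-- A Clarkson–McCarthy inequality. For `f t = t ^ (p / 2)` with `p ≥ 2` it reads
`‖A + B‖ₚᵖ + ‖A - B‖ₚᵖ ≤ 2 ^ (p - 1) * (‖A‖ₚᵖ + ‖B‖ₚᵖ)`. With
`N = AᴴA + BᴴB`, superadditivity bounds the left side of the statement by `2 tr f(2 N)`, and midpoint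
convexity for the function `t ↦ f (4 * t)` bounds that by the right side. -/
theorem ConvexOn.singularSum_add_singularSum_sub_le (hf : ConvexOn ℝ (Set.Ici 0) f)
    (hf0 : f 0 = 0) :
    2 * (singularSum f (A + B) + singularSum f (A - B)) ≤
      singularSum (fun t => f (4 * t)) A + singularSum (fun t => f (4 * t)) B := by
  have h0 := eigenvalues_conjTranspose_mul_self_nonneg (𝕜 := ℂ) (m := n) (n := n)
  have hN := (posSemidef_conjTranspose_mul_self_add A B).eigenvalues_nonneg
  have h1 := hf.sum_add_sum_le_of_quadForm_add hf0 _ _ _ (h0 _) (h0 _)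
    (fun k => mul_nonneg two_pos.le (hN k)) (sum_eigenvalues_add_sum_eigenvalues_sub A B)
  have h2 := (hf.comp_mul_left_Ici (c := 4) (by norm_num)).two_mul_sum_half_le_of_quadForm_add
    _ _ _ (h0 _) (h0 _) (sum_eigenvalues_add_sum_eigenvalues A B)
  simp only [show ∀ t : ℝ, 4 * (t / 2) = 2 * t by intro t; ring] at h2
  exact (mul_le_mul_of_nonneg_left h1 two_pos.le).trans h2

/-- A Clarkson–McCarthy inequality for concave functions. For `f t = t ^ (p / 2)` with
`0 < p ≤ 2` it reads `‖A + B‖ₚᵖ + ‖A - B‖ₚᵖ ≤ 2 * (‖A‖ₚᵖ + ‖B‖ₚᵖ)`. -/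
theorem ConcaveOn.singularSum_add_singularSum_sub_le (hf : ConcaveOn ℝ (Set.Ici 0) f)
    (hf0 : f 0 = 0) :
    singularSum f (A + B) + singularSum f (A - B) ≤ 2 * (singularSum f A + singularSum f B) := by
  have h0 := eigenvalues_conjTranspose_mul_self_nonneg (𝕜 := ℂ) (m := n) (n := n)
  have hN := (posSemidef_conjTranspose_mul_self_add A B).eigenvalues_nonneg
  have h1 := hf.neg.two_mul_sum_half_le_of_quadForm_add _ _ _ (h0 _) (h0 _)
    (sum_eigenvalues_add_sum_eigenvalues_sub A B)
  have h2 := hf.neg.sum_add_sum_le_of_quadForm_add (by simp [hf0]) _ _ _ (h0 _) (h0 _) hN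
    (sum_eigenvalues_add_sum_eigenvalues A B)
  simp only [Pi.neg_apply, Finset.sum_neg_distrib, mul_div_cancel_left₀ _ (two_ne_zero' ℝ)]
    at h1 h2
  unfold singularSum
  linarith

end Clarkson

/-! ### Block matrices and their diagonal and off-diagonal parts -/

section Pinching

variable {f : ℝ → ℝ} (A : Matrix m m ℂ) (B : Matrix m n ℂ) (C : Matrix n m ℂ) (D : Matrix n n ℂ)

theorem singularSum_diag_add_offDiag :
    singularSum f (fromBlocks A 0 0 D + fromBlocks 0 B C 0) = singularSum f (fromBlocks A B C D) := by
  simp [fromBlocks_add]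

theorem singularSum_diag_sub_offDiag :
    singularSum f (fromBlocks A 0 0 D - fromBlocks 0 B C 0) = singularSum f (fromBlocks A B C D) := by
  rw [sub_eq_add_neg, fromBlocks_neg, fromBlocks_add, ← singularSum_fromBlocks_neg f A B C D]
  simp

/-- The Clarkson–McCarthy inequality for the block diagonal part and the block off-diagonal part,
whose sum and difference have the same singular values. -/
theorem ConvexOn.singularSum_fromBlocks_le (hf : ConvexOn ℝ (Set.Ici 0) f) (hf0 : f 0 = 0) :
    4 * singularSum f (fromBlocks A B C D) ≤
      singularSum (fun t => f (4 * t)) A + singularSum (fun t => f (4 * t)) D +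
        singularSum (fun t => f (4 * t)) (fromBlocks 0 B C 0) := by
  have h := hf.singularSum_add_singularSum_sub_le (fromBlocks A 0 0 D) (fromBlocks 0 B C 0) hf0
  rw [singularSum_diag_add_offDiag, singularSum_diag_sub_offDiag, singularSum_fromBlocks_diag] at h
  linarith

theorem ConcaveOn.singularSum_fromBlocks_le (hf : ConcaveOn ℝ (Set.Ici 0) f) (hf0 : f 0 = 0) :
    singularSum f (fromBlocks A B C D) ≤
      singularSum f A + singularSum f D + singularSum f (fromBlocks 0 B C 0) := by
  have h := hf.singularSum_add_singularSum_sub_le (fromBlocks A 0 0 D) (fromBlocks 0 B C 0) hf0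
  rw [singularSum_diag_add_offDiag, singularSum_diag_sub_offDiag, singularSum_fromBlocks_diag] at h
  linarith

end Pinching

end SingularSum

/-! ### Schatten norms and numerical radii of block matrices -/

section Schatten

variable {m n : Type*} [Fintype m] [DecidableEq m] [Fintype n] [DecidableEq n]

theorem matrixSingularValues_sq (X : Matrix n n ℂ) (i : n) :
    matrixSingularValues X i ^ 2 = (isHermitian_conjTranspose_mul_self X).eigenvalues i :=
  Real.sq_sqrt (eigenvalues_conjTranspose_mul_self_nonneg X i)

theorem matrixSingularValues_nonneg (X : Matrix n n ℂ) (i : n) : 0 ≤ matrixSingularValues X i :=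
  Real.sqrt_nonneg _

theorem schattenNorm_nonneg {p : ℝ≥0∞} (hp : 1 ≤ p) (X : Matrix n n ℂ) : 0 ≤ schattenNorm p X :=
  have := Fact.mk hp
  norm_nonneg _

/-- For finite `p`, the `p`-th power of the Schatten norm is the trace of `(Xᴴ X) ^ (p / 2)`. -/
theorem schattenNorm_rpow {p : ℝ≥0∞} (hp : 0 < p.toReal) (X : Matrix n n ℂ) :
    schattenNorm p X ^ p.toReal = singularSum (fun t => t ^ (p.toReal / 2)) X := by
  have h0 : ∀ i, 0 ≤ matrixSingularValues X i ^ p.toReal := fun i =>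
    Real.rpow_nonneg (matrixSingularValues_nonneg X i) _
  simp only [schattenNorm, PiLp.norm_eq_sum hp, Real.norm_eq_abs,
    abs_of_nonneg (matrixSingularValues_nonneg X _)]
  rw [← Real.rpow_mul (Finset.sum_nonneg fun i _ => h0 i), one_div_mul_cancel hp.ne', Real.rpow_one]
  refine Finset.sum_congr rfl fun i _ => ?_
  beta_reduce
  rw [← matrixSingularValues_sq, ← Real.rpow_natCast,
    ← Real.rpow_mul (matrixSingularValues_nonneg X i), Nat.cast_ofNat,
    mul_div_cancel₀ _ (two_ne_zero' ℝ)]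

theorem schattenNorm_top_le_iff {X : Matrix n n ℂ} {c : ℝ} (hc : 0 ≤ c) :
    schattenNorm ∞ X ≤ c ↔
      ∀ i, (isHermitian_conjTranspose_mul_self X).eigenvalues i ≤ c ^ 2 := by
  have h : ∀ i, ‖matrixSingularValues X i‖ ≤ c ↔
      (isHermitian_conjTranspose_mul_self X).eigenvalues i ≤ c ^ 2 := fun i => by
    rw [← matrixSingularValues_sq, Real.norm_eq_abs,
      abs_of_nonneg (matrixSingularValues_nonneg X i),
      pow_le_pow_iff_left₀ (matrixSingularValues_nonneg X i) hc two_ne_zero]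
  simp only [← h, schattenNorm, PiLp.norm_eq_ciSup]
  exact ⟨fun h i => (le_ciSup (Set.finite_range fun i => ‖matrixSingularValues X i‖).bddAbove
    i).trans h, fun h => Real.iSup_le h hc⟩

/-- The squared operator norm is at most the squared Frobenius norm. -/
theorem eigenvalues_conjTranspose_mul_self_le (X : Matrix n n ℂ) (i : n) :
    (isHermitian_conjTranspose_mul_self X).eigenvalues i ≤ ∑ k, ∑ l, ‖X l k‖ ^ 2 := by
  have h := congrArg Complex.re (isHermitian_conjTranspose_mul_self X).trace_eq_sum_eigenvalues
  have h2 : (Xᴴ * X).trace.re = ∑ k, ∑ l, ‖X l k‖ ^ 2 := by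
    simp only [trace, diag_apply, mul_apply, conjTranspose_apply, Complex.re_sum, RCLike.star_def,
      Complex.conj_mul', ← Complex.ofReal_pow, Complex.ofReal_re]
  rw [← h2, h]
  simp only [Complex.coe_algebraMap, Complex.re_sum, Complex.ofReal_re, RCLike.ofReal]
  exact Finset.single_le_sum (f := (isHermitian_conjTranspose_mul_self X).eigenvalues)
    (fun j _ => eigenvalues_conjTranspose_mul_self_nonneg X j) (Finset.mem_univ i)

/-- The supremum defining `schattenRadius` is a genuine one: the entries of `ℜ (exp (i θ) • X)`,
hence its singular values, are bounded uniformly in `θ`. -/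
theorem bddAbove_schattenNorm_realPart {p : ℝ≥0∞} (hp : 1 ≤ p) (X : Matrix n n ℂ) :
    BddAbove (Set.range fun θ : ℝ =>
      schattenNorm p ((ℜ (Complex.exp (θ * Complex.I) • X) : Matrix n n ℂ))) := by
  have := Fact.mk hp
  have hentry : ∀ (θ : ℝ) (k l : n), ‖(ℜ (Complex.exp (θ * Complex.I) • X) : Matrix n n ℂ) l k‖ ≤
      2⁻¹ * (‖X l k‖ + ‖X k l‖) := by
    intro θ k l
    rw [realPart_apply_coe, Matrix.smul_apply, Matrix.add_apply, norm_smul, star_apply,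
      Matrix.smul_apply, Matrix.smul_apply]
    refine (mul_le_mul_of_nonneg_left (norm_add_le _ _) (norm_nonneg _)).trans_eq ?_
    simp [Complex.norm_exp_ofReal_mul_I]
  -- a bound for the squared Frobenius norm, uniform in `θ`
  set M : ℝ := ∑ k, ∑ l, (2⁻¹ * (‖X l k‖ + ‖X k l‖)) ^ 2
  have hcont : Continuous fun σ : n → ℝ => ‖(WithLp.toLp p σ : PiLp p fun _ : n => ℝ)‖ :=
    (PiLp.continuous_toLp p _).norm
  have hcomp : IsCompact (Set.univ.pi fun _ : n => Set.Icc (0 : ℝ) (√M)) :=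
    isCompact_univ_pi fun _ => isCompact_Icc
  refine (hcomp.image hcont).bddAbove.mono ?_
  rintro _ ⟨θ, rfl⟩
  refine ⟨_, fun i _ => ⟨matrixSingularValues_nonneg _ i, Real.sqrt_le_sqrt ?_⟩, rfl⟩
  refine (eigenvalues_conjTranspose_mul_self_le _ i).trans ?_
  exact Finset.sum_le_sum fun k _ => Finset.sum_le_sum fun l _ =>
    pow_le_pow_left₀ (norm_nonneg _) (hentry θ k l) 2

theorem schattenNorm_le_schattenRadius {p : ℝ≥0∞} (hp : 1 ≤ p) (X : Matrix n n ℂ) (θ : ℝ) :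
    schattenNorm p ((ℜ (Complex.exp (θ * Complex.I) • X) : Matrix n n ℂ)) ≤ schattenRadius p X :=
  le_ciSup (bddAbove_schattenNorm_realPart hp X) θ

theorem schattenRadius_nonneg {p : ℝ≥0∞} (hp : 1 ≤ p) (X : Matrix n n ℂ) :
    0 ≤ schattenRadius p X :=
  Real.iSup_nonneg fun _ => schattenNorm_nonneg hp _

theorem singularSum_le_schattenRadius_rpow {p : ℝ≥0∞} (hp : 1 ≤ p) (hp' : p ≠ ∞)
    (X : Matrix n n ℂ) (θ : ℝ) :
    singularSum (fun t => t ^ (p.toReal / 2)) (ℜ (Complex.exp (θ * Complex.I) • X) : Matrix n n ℂ) ≤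
      schattenRadius p X ^ p.toReal := by
  have h : 0 < p.toReal := ENNReal.toReal_pos (zero_lt_one.trans_le hp).ne' hp'
  rw [← schattenNorm_rpow h]
  exact Real.rpow_le_rpow (schattenNorm_nonneg hp _) (schattenNorm_le_schattenRadius hp X θ) h.le

theorem schattenRadius_rpow_le {p : ℝ≥0∞} (hp : 1 ≤ p) (hp' : p ≠ ∞) {X : Matrix n n ℂ} {R : ℝ}
    (hR : ∀ θ : ℝ, singularSum (fun t => t ^ (p.toReal / 2))
      (ℜ (Complex.exp (θ * Complex.I) • X) : Matrix n n ℂ) ≤ R) :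
    schattenRadius p X ^ p.toReal ≤ R := by
  have h : 0 < p.toReal := ENNReal.toReal_pos (zero_lt_one.trans_le hp).ne' hp'
  have hθ : ∀ θ : ℝ, schattenNorm p ((ℜ (Complex.exp (θ * Complex.I) • X) : Matrix n n ℂ)) ^
      p.toReal ≤ R := fun θ => (schattenNorm_rpow h _).trans_le (hR θ)
  have hR0 : 0 ≤ R := (Real.rpow_nonneg (schattenNorm_nonneg hp _) _).trans (hθ 0)
  rw [← Real.le_rpow_inv_iff_of_pos (schattenRadius_nonneg hp X) hR0 h]
  exact ciSup_le fun θ => (Real.le_rpow_inv_iff_of_pos (schattenNorm_nonneg hp _) hR0 h).2 (hθ θ)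

/-- For `z = exp (i θ)`, the upper right block of `ℜ (z • [[A, B], [C, D]])`. -/
noncomputable def realPartOffDiag {m n : Type*} (z : ℂ) (B : Matrix m n ℂ) (C : Matrix n m ℂ) : Matrix m n ℂ :=
  (2⁻¹ : ℝ) • (z • B + (z • C)ᴴ)

theorem realPart_smul_fromBlocks {m n : Type*} (z : ℂ) (A : Matrix m m ℂ) (B : Matrix m n ℂ) (C : Matrix n m ℂ)
    (D : Matrix n n ℂ) :
    (ℜ (z • fromBlocks A B C D) : Matrix (m ⊕ n) (m ⊕ n) ℂ) =
      fromBlocks (ℜ (z • A) : Matrix m m ℂ) (realPartOffDiag z B C)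
        (realPartOffDiag z B C)ᴴ (ℜ (z • D) : Matrix n n ℂ) := by
  simp only [realPart_apply_coe, star_eq_conjTranspose, fromBlocks_smul, fromBlocks_conjTranspose,
    fromBlocks_add, realPartOffDiag, conjTranspose_smul, conjTranspose_add,
    conjTranspose_conjTranspose, star_trivial, star_star]
  rw [add_comm (z • C)]

theorem realPart_smul_scaledOffDiag {m n : Type*} (p : ℝ≥0∞) (z : ℂ) (B : Matrix m n ℂ) (C : Matrix n m ℂ) :
    (ℜ (z • scaledOffDiag p B C) : Matrix (m ⊕ n) (m ⊕ n) ℂ) =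
      (2 : ℝ) ^ (-(p⁻¹).toReal) •
        fromBlocks 0 (realPartOffDiag z B C) (realPartOffDiag z B C)ᴴ 0 := by
  rw [scaledOffDiag, smul_comm, map_smul, selfAdjoint.val_smul, realPart_smul_fromBlocks]
  simp

theorem fromBlocks_realPartOffDiag_swap {m n : Type*} (z : ℂ) (B : Matrix m n ℂ) (C : Matrix n m ℂ) :
    fromBlocks 0 (realPartOffDiag z C B) (realPartOffDiag z C B)ᴴ 0 =
      reindex (Equiv.sumComm m n) (Equiv.sumComm m n)
        (fromBlocks 0 (realPartOffDiag z B C) (realPartOffDiag z B C)ᴴ 0) := by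
  have h : realPartOffDiag z C B = (realPartOffDiag z B C)ᴴ := by
    simp [realPartOffDiag, add_comm]
  rw [h, conjTranspose_conjTranspose]
  ext (i | i) (j | j) <;> simp

/-- Each of the two scaled off-diagonal parts carries half of `‖·‖ₚᵖ` of the off-diagonal part. -/
theorem singularSum_offDiag_le {p : ℝ≥0∞} (hp : 1 ≤ p) (hp' : p ≠ ∞)
    (B : Matrix m n ℂ) (C : Matrix n m ℂ) (θ : ℝ) :
    singularSum (fun t => t ^ (p.toReal / 2))
      (fromBlocks 0 (realPartOffDiag (Complex.exp (θ * Complex.I)) B C)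
        (realPartOffDiag (Complex.exp (θ * Complex.I)) B C)ᴴ 0) ≤
      2 * schattenRadius p (scaledOffDiag p B C) ^ p.toReal := by
  have h : 0 < p.toReal := ENNReal.toReal_pos (zero_lt_one.trans_le hp).ne' hp'
  have hc : (((2 : ℝ) ^ (-(p⁻¹).toReal)) ^ 2) ^ (p.toReal / 2) = 2⁻¹ := by
    rw [← Real.rpow_natCast, ← Real.rpow_mul two_pos.le, ← Real.rpow_mul two_pos.le,
      ENNReal.toReal_inv, Nat.cast_ofNat,
      show -p.toReal⁻¹ * 2 * (p.toReal / 2) = -1 by field_simp, Real.rpow_neg_one]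
  have h1 := singularSum_le_schattenRadius_rpow hp hp' (scaledOffDiag p B C) θ
  rw [realPart_smul_scaledOffDiag, singularSum_real_smul, singularSum_congr
    (fun t ht => Real.mul_rpow (sq_nonneg _) ht), singularSum_mul_left, hc] at h1
  linarith

theorem singularSum_offDiag_le_add {p : ℝ≥0∞} (hp : 1 ≤ p) (hp' : p ≠ ∞)
    (B : Matrix m n ℂ) (C : Matrix n m ℂ) (θ : ℝ) :
    singularSum (fun t => t ^ (p.toReal / 2))
      (fromBlocks 0 (realPartOffDiag (Complex.exp (θ * Complex.I)) B C)
        (realPartOffDiag (Complex.exp (θ * Complex.I)) B C)ᴴ 0) ≤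
      schattenRadius p (scaledOffDiag p B C) ^ p.toReal +
        schattenRadius p (scaledOffDiag p C B) ^ p.toReal := by
  have h1 := singularSum_offDiag_le hp hp' B C θ
  have h2 := singularSum_offDiag_le hp hp' C B θ
  rw [fromBlocks_realPartOffDiag_swap, singularSum_reindex] at h2
  linarith

/-- The operator norm bound follows from the convex Clarkson–McCarthy inequality for
`f t = max (t - (2 c)²) 0`: a singular value exceeds `2 c` exactly when `tr f(Xᴴ X)` is positive. -/
theorem schattenNorm_top_fromBlocks_le {A : Matrix m m ℂ} {B : Matrix m n ℂ} {C : Matrix n m ℂ}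
    {D : Matrix n n ℂ} {c : ℝ} (hc : 0 ≤ c) (hA : schattenNorm ∞ A ≤ c) (hD : schattenNorm ∞ D ≤ c)
    (hBC : schattenNorm ∞ (fromBlocks 0 B C 0) ≤ c) :
    schattenNorm ∞ (fromBlocks A B C D) ≤ 2 * c := by
  rw [schattenNorm_top_le_iff hc] at hA hD hBC
  rw [schattenNorm_top_le_iff (by positivity)]
  set f : ℝ → ℝ := fun t => max (t - (2 * c) ^ 2) 0
  have hf : ConvexOn ℝ (Set.Ici 0) f :=
    ((convexOn_id (convex_Ici 0)).sub (concaveOn_const _ (convex_Ici 0))).sup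
      (convexOn_const 0 (convex_Ici 0))
  have hf0 : f 0 = 0 := max_eq_right (by nlinarith)
  have hz : ∀ t, t ≤ c ^ 2 → f (4 * t) = 0 := fun t ht => max_eq_right (by linarith)
  have h := hf.singularSum_fromBlocks_le A B C D hf0
  simp only [singularSum, hz _ (hA _), hz _ (hD _), hz _ (hBC _), Finset.sum_const_zero,
    add_zero] at h
  intro i
  have hi := Finset.single_le_sum (f := fun i => f ((isHermitian_conjTranspose_mul_self
    (fromBlocks A B C D)).eigenvalues i)) (fun j _ => le_max_right _ _) (Finset.mem_univ i)
  have := (le_max_left _ 0).trans hi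
  linarith

end Schatten

/-! ### Comparison of the numerical radius with those of the blocks -/

theorem mainTheorem4 {m n : Type*} [Fintype m] [DecidableEq m] [Fintype n] [DecidableEq n]
    (A₁₁ : Matrix m m ℂ) (A₁₂ : Matrix m n ℂ) (A₂₁ : Matrix n m ℂ) (A₂₂ : Matrix n n ℂ) :
    (∀ p : ℝ≥0∞, 2 ≤ p → p ≠ ∞ →
      schattenRadius p (Matrix.fromBlocks A₁₁ A₁₂ A₂₁ A₂₂) ^ p.toReal ≤
        (2 : ℝ) ^ (p.toReal - 2) *
          (schattenRadius p A₁₁ ^ p.toReal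
            + schattenRadius p (scaledOffDiag p A₁₂ A₂₁) ^ p.toReal
            + schattenRadius p (scaledOffDiag p A₂₁ A₁₂) ^ p.toReal
            + schattenRadius p A₂₂ ^ p.toReal)) ∧
    (schattenRadius ∞ (Matrix.fromBlocks A₁₁ A₁₂ A₂₁ A₂₂) ≤
        2 * max (max (schattenRadius ∞ A₁₁) (schattenRadius ∞ (scaledOffDiag ∞ A₁₂ A₂₁)))
              (max (schattenRadius ∞ (scaledOffDiag ∞ A₂₁ A₁₂)) (schattenRadius ∞ A₂₂))) ∧
    (∀ p : ℝ≥0∞, 1 ≤ p → p ≤ 2 →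
      schattenRadius p (Matrix.fromBlocks A₁₁ A₁₂ A₂₁ A₂₂) ^ p.toReal ≤
        schattenRadius p A₁₁ ^ p.toReal
          + schattenRadius p (scaledOffDiag p A₁₂ A₂₁) ^ p.toReal
          + schattenRadius p (scaledOffDiag p A₂₁ A₁₂) ^ p.toReal
          + schattenRadius p A₂₂ ^ p.toReal) := by
  refine ⟨fun p hp hp' => ?_, ?_, fun p hp hp2 => ?_⟩
  · have h1 : 1 ≤ p := one_le_two.trans hp
    have hr : 2 ≤ p.toReal := by simpa using ENNReal.toReal_mono hp' hp
    refine schattenRadius_rpow_le h1 hp' fun θ => ?_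
    rw [realPart_smul_fromBlocks]
    have h := (convexOn_rpow (p := p.toReal / 2) (by linarith)).singularSum_fromBlocks_le
      (ℜ (Complex.exp (θ * Complex.I) • A₁₁) : Matrix m m ℂ)
      (realPartOffDiag (Complex.exp (θ * Complex.I)) A₁₂ A₂₁)
      (realPartOffDiag (Complex.exp (θ * Complex.I)) A₁₂ A₂₁)ᴴ
      (ℜ (Complex.exp (θ * Complex.I) • A₂₂) : Matrix n n ℂ)
      (Real.zero_rpow (by linarith))
    simp only [singularSum_congr (fun t ht => Real.mul_rpow (show (0 : ℝ) ≤ 4 by norm_num) ht),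
      singularSum_mul_left] at h
    have hA := singularSum_le_schattenRadius_rpow h1 hp' A₁₁ θ
    have hD := singularSum_le_schattenRadius_rpow h1 hp' A₂₂ θ
    have hO := singularSum_offDiag_le_add h1 hp' A₁₂ A₂₁ θ
    -- the constant `2 ^ (p - 2)` arises as `4 ^ (p / 2) / 4`
    have h4 : (4 : ℝ) ^ (p.toReal / 2) = 4 * 2 ^ (p.toReal - 2) := by
      rw [show (4 : ℝ) = 2 ^ (2 : ℝ) by norm_num, ← Real.rpow_mul two_pos.le,
        ← Real.rpow_add two_pos]
      congr 1
      ring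
    rw [h4, ← mul_add, ← mul_add, mul_assoc] at h
    refine (le_of_mul_le_mul_left h (by norm_num)).trans ?_
    gcongr ?_ * ?_
    linarith
  · refine ciSup_le fun θ => ?_
    rw [realPart_smul_fromBlocks]
    have hO := schattenNorm_le_schattenRadius le_top (scaledOffDiag ∞ A₁₂ A₂₁) θ
    rw [realPart_smul_scaledOffDiag] at hO
    simp only [ENNReal.inv_top, ENNReal.toReal_zero, neg_zero, Real.rpow_zero, one_smul] at hO
    refine schattenNorm_top_fromBlocks_le ?_ ?_ ?_ ?_
    · exact (schattenRadius_nonneg le_top A₁₁).trans ((le_max_left _ _).trans (le_max_left _ _))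
    · exact (schattenNorm_le_schattenRadius le_top A₁₁ θ).trans
        ((le_max_left _ _).trans (le_max_left _ _))
    · exact (schattenNorm_le_schattenRadius le_top A₂₂ θ).trans
        ((le_max_right _ _).trans (le_max_right _ _))
    · exact hO.trans ((le_max_right _ _).trans (le_max_left _ _))
  · have hp' : p ≠ ∞ := (hp2.trans_lt ENNReal.ofNat_lt_top).ne
    have hr : 1 ≤ p.toReal := by simpa using ENNReal.toReal_mono hp' hp
    have hr2 : p.toReal ≤ 2 := by simpa using ENNReal.toReal_mono (by simp) hp2
    refine schattenRadius_rpow_le hp hp' fun θ => ?_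
    rw [realPart_smul_fromBlocks]
    have h := (Real.concaveOn_rpow (p := p.toReal / 2) (by linarith)
      (by linarith)).singularSum_fromBlocks_le
      (ℜ (Complex.exp (θ * Complex.I) • A₁₁) : Matrix m m ℂ)
      (realPartOffDiag (Complex.exp (θ * Complex.I)) A₁₂ A₂₁)
      (realPartOffDiag (Complex.exp (θ * Complex.I)) A₁₂ A₂₁)ᴴ
      (ℜ (Complex.exp (θ * Complex.I) • A₂₂) : Matrix n n ℂ)
      (Real.zero_rpow (by linarith))
    have hA := singularSum_le_schattenRadius_rpow hp hp' A₁₁ θ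
    have hD := singularSum_le_schattenRadius_rpow hp hp' A₂₂ θ
    have hO := singularSum_offDiag_le_add hp hp' A₁₂ A₂₁ θ
    linarith
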